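/- Let $\kappa\ge 1$ and $n\ge 2$ be integers. For $\sigma\in SO(\kappa)$ and $x\in\mathbb R^{\kappa n}$ let $R_\sigma(x)=(\sigma(x_1,\dots,x_\kappa),\dots,\sigma(x_{\kappa(n-1)+1},\dots,x_{\kappa n}))$. Let $\{\sigma_0=\mathrm{Id},\sigma_1,\dots,\sigma_{\kappa-1}\}\subset SO(\kappa)$ be an orthogonal sequence of rotations, that is, for every $v\in\mathbb R^\kappa$ the vectors $v,\sigma_1v,\dots,\sigma_{\kappa-1}v$ are mutually orthogonal. For $\xi\in S^{\kappa n-1}$ let $H_\xi$ be the orthogonal complement in $\mathbb R^{\kappa n}$ of the $\kappa$-dimensional subspace spanned by $\xi,R_{\sigma_1}(\xi),\dots,R_{\sigma_{\kappa-1}}(\xi)$. Let $K$ be an origin-symmetric convex body (compact, convex, with non-empty interior) in $\mathbb R^{\kappa n}$ with Minkowski functional $\|x\|_K=\min\{\alpha\ge 0: x\in\alpha K\}$. Suppose that $K$ is infinitely smooth, i.e. the restriction of $\|\cdot\|_K$ to $S^{\kappa n-1}$ is in $C^\infty(S^{\kappa n-1})$, and $R_\sigma$-invariant, i.e. $\|R_\sigma(x)\|_K=\|x\|_K$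 for all $\sigma\in SO(\kappa)$ and $x\in\mathbb R^{\kappa n}$. Then the Fourier transform of the tempered distribution $\|x\|_K^{-\kappa n+\kappa}$ (defined by $\langle\hat f,\varphi\rangle=\langle f,\hat\varphi\rangle$ for Schwartz functions $\varphi$, with $\hat\varphi(y)=\int\varphi(x)e^{-i\langle x,y\rangle}\,dx$) is given by integration against a function that is continuous on $\mathbb R^{\kappa n}\setminus\{0\}$, and the values $(\|x\|_K^{-\kappa n+\kappa})^\wedge(\xi)$ of this function satisfy, for every $\xi\in S^{\kappa n-1}$, $$\mathrm{Vol}_{\kappa n-\kappa}(K\cap H_\xi)=\frac{2^{-\kappa+1}\pi^{-\kappa/2}}{(\kappa n-\kappa)\,\Gamma(\kappa/2)}\,\bigl(\|x\|_K^{-\kappa n+\kappa}\bigr)^\wedge(\xi).$$ -/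

import Mathlib

open MeasureTheory
open scoped SchwartzMap Manifold ContDiff RealInnerProductSpace

noncomputable section

namespace BlockRotation

/-- The Euclidean space `ℝ^{κn}`. The coordinate `(j, i)` is the `i`-th entry of the `j`-th
`κ`-tuple, i.e. the coordinate number `κ j + i` (counted from `0`). -/
abbrev Space (κ n : ℕ) : Type := EuclideanSpace ℝ (Fin n × Fin κ)

/-- `R_σ x`: the rotation `σ ∈ SO(κ)` is applied to each of the `n` consecutive `κ`-tuples
of coordinates of `x`. -/
def R {κ n : ℕ} (σ : Matrix.specialOrthogonalGroup (Fin κ) ℝ) (x : Space κ n) : Space κ n :=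
  WithLp.toLp 2 fun p => ((σ : Matrix (Fin κ) (Fin κ) ℝ).mulVec fun i => x (p.1, i)) p.2

/-- `D` is `R_σ`-invariant: `‖R_σ x‖_D = ‖x‖_D` for all `σ ∈ SO(κ)` and all `x`, where
`‖·‖_D` is the Minkowski functional (`gauge D`). -/
def IsRInvariant {κ n : ℕ} (D : Set (Space κ n)) : Prop :=
  ∀ (σ : Matrix.specialOrthogonalGroup (Fin κ) ℝ) (x : Space κ n), gauge D (R σ x) = gauge D x

/-- `σ₀ = Id, σ₁, …, σ_{κ-1}` is an orthogonal sequence of rotations in `SO(κ)`: for every vector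
`v` of `ℝ^κ`, the vectors `v, σ₁ v, …, σ_{κ-1} v` are mutually orthogonal. -/
structure IsOrthogonalSequence {κ : ℕ} [NeZero κ]
    (σ : Fin κ → Matrix.specialOrthogonalGroup (Fin κ) ℝ) : Prop where
  zero_eq_one : σ 0 = 1
  orthogonal : ∀ i j : Fin κ, i ≠ j → ∀ v : Fin κ → ℝ,
    dotProduct ((σ i : Matrix (Fin κ) (Fin κ) ℝ).mulVec v)
      ((σ j : Matrix (Fin κ) (Fin κ) ℝ).mulVec v) = 0

/-- The subspace `H_ξ`: the orthogonal complement of the span of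
`ξ, R_{σ₁} ξ, …, R_{σ_{κ-1}} ξ`. -/
def H {κ n : ℕ} (σ : Fin κ → Matrix.specialOrthogonalGroup (Fin κ) ℝ) (ξ : Space κ n) :
    Submodule ℝ (Space κ n) :=
  (Submodule.span ℝ (Set.range fun j => R (σ j) ξ))ᗮ

section General

variable {E : Type*} [NormedAddCommGroup E] [InnerProductSpace ℝ E] [FiniteDimensional ℝ E]
  [MeasurableSpace E] [BorelSpace E]

/-- The volume of the section `K ∩ V`, for the Lebesgue measure of the Euclidean space `V`
(of dimension `dim V`). The instance is given explicitly, because the subtype measure that `V`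
also inherits from `E` vanishes on proper subspaces. -/
def sectionVolume (K : Set E) (V : Submodule ℝ E) : ℝ :=
  (@volume V measureSpaceOfInnerProductSpace ((fun x : V => (x : E)) ⁻¹' K)).toReal

/-- `D` is infinitely smooth: the restriction of its Minkowski functional to the unit sphere is a
`C^∞` function on the sphere, where `d + 1` is the dimension of `E`. -/
def IsInfinitelySmooth (D : Set E) : Prop :=
  ∀ (d : ℕ) [Fact (Module.finrank ℝ E = d + 1)],
    ContMDiff (𝓡 d) 𝓘(ℝ, ℝ) ∞ (fun x : Metric.sphere (0 : E) 1 => gauge D (x : E))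

/-- The Fourier transform `φ̂(y) = ∫ φ(x) e^{-i⟨x, y⟩} dx` of a test function. -/
def testFourier (φ : 𝓢(E, ℂ)) (y : E) : ℂ :=
  ∫ x : E, Complex.exp (-(Complex.I * ((⟪x, y⟫ : ℝ) : ℂ))) * φ x

/-- The function `f` acts as a distribution on test functions, its Fourier transform
`φ ↦ ⟨f, φ̂⟩` is given by integration against `g`, and `g` is continuous outside of the origin
(which determines the values of `g` there). -/
structure IsFourierTransform (f : E → ℝ) (g : E → ℂ) : Prop where
  integrable_left : ∀ φ : 𝓢(E, ℂ), Integrable (fun x => (f x : ℂ) * φ x)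
  integrable_right : ∀ φ : 𝓢(E, ℂ), Integrable (fun x => g x * φ x)
  integral_eq : ∀ φ : 𝓢(E, ℂ), ∫ x, g x * φ x = ∫ x, (f x : ℂ) * testFourier φ x
  continuousOn : ContinuousOn g {0}ᶜ

end General

end BlockRotation

end

/-! Write `p = κn - κ` and pick a smooth `η ≥ 0` supported in `[1, 3]`. Then `h(x) = η(‖x‖_K)` is a
test function, and homogeneity of the gauge gives `I ‖x‖_K^{-p} = ∫₀^∞ s^{-p-1} h(x/s) ds` with `I =
∫₀^∞ t^{p-1} η(t) dt > 0`. The singular power is thus a superposition of dilates of one Schwartz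
function. Transforming under the integral (`isFourierTransform_radialFourier`) shows that `I⁻¹ ∫₀^∞
s^{κ-1} ĥ(sξ) ds` is its Fourier transform, a function continuous off the origin. By
`IsFourierTransform.eqOn_compl_zero`, no other choice of values is possible there.

It remains to evaluate the radial integral at a unit vector `ξ`. A unit combination `∑ c_j σ_j` is
an orthogonal matrix, and for `κ ≥ 2` it has determinant 1 by connectedness of the sphere; for `κ =
1` it is `±1`. Since `ĥ` inherits rotation invariance and evenness from `h`, it is radial on the
`κ`-dimensional space `H_ξ^⊥` (`IsOrthogonalSequence.apply_sum_smul_R`). In polar coordinates the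
radial integral, times the area of `S^{κ-1}`, is therefore `∫ ĥ` over `H_ξ^⊥`, which equals `(2π)^κ
∫ h` over `H_ξ` (`integral_testFourier_comp_isometry`). Polar coordinates for the norm `‖·‖_K` on
`H_ξ` turn the last integral into `p · Vol(K ∩ H_ξ) · I`, and `I` cancels. -/

namespace BlockRotation

open Set FourierTransform

/-! ### Normalization of the Fourier transform and the multiplication formula -/

section Fourier

variable {E : Type*} [NormedAddCommGroup E] [InnerProductSpace ℝ E] [FiniteDimensional ℝ E]
  [MeasurableSpace E] [BorelSpace E]

theorem testFourier_eq_fourier (φ : 𝓢(E, ℂ)) (y : E) :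
    testFourier φ y = 𝓕 φ ((2 * Real.pi)⁻¹ • y) := by
  rw [SchwartzMap.fourier_coe, Real.fourier_eq', testFourier]
  congr 1 with x
  rw [smul_eq_mul, inner_smul_right]
  congr 2
  have : (Real.pi : ℂ) ≠ 0 := by exact_mod_cast Real.pi_ne_zero
  push_cast
  field_simp

theorem exists_schwartzMap_eq_testFourier (φ : 𝓢(E, ℂ)) :
    ∃ ψ : 𝓢(E, ℂ), ∀ y, ψ y = testFourier φ y := by
  have h : (2 * Real.pi)⁻¹ ≠ 0 := by positivity
  refine ⟨SchwartzMap.compCLMOfContinuousLinearEquiv ℂ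
    (ContinuousLinearEquiv.smulLeft (Units.mk0 _ h) : E ≃L[ℝ] E) (𝓕 φ), fun y => ?_⟩
  rw [testFourier_eq_fourier]
  rfl

theorem continuous_testFourier (φ : 𝓢(E, ℂ)) : Continuous (testFourier φ) := by
  obtain ⟨ψ, hψ⟩ := exists_schwartzMap_eq_testFourier φ
  rw [← funext hψ]
  exact ψ.continuous

/-- This is Fubini for the kernel `e^{-is⟨x,y⟩}`; putting the dilation into the bilinear pairing
keeps the formula symmetric in `h` and `φ`. -/
theorem integral_testFourier_smul_mul (h φ : 𝓢(E, ℂ)) (s : ℝ) :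
    ∫ y, testFourier h (s • y) * φ y = ∫ x, h x * testFourier φ (s • x) := by
  have key := VectorFourier.integral_bilin_fourierIntegral_eq_flip (ContinuousLinearMap.mul ℂ ℂ)
    (L := ((2 * Real.pi)⁻¹ * s) • innerₗ E) (μ := volume) (ν := volume) (f := h) (g := φ)
    Real.continuous_fourierChar
    (by simp only [LinearMap.smul_apply, innerₗ_apply_apply]; fun_prop) h.integrable φ.integrable
  have e1 : ∀ y, testFourier h (s • y) = VectorFourier.fourierIntegral Real.fourierChar volume
      (((2 * Real.pi)⁻¹ * s) • innerₗ E) h y := by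
    intro y
    rw [testFourier_eq_fourier, smul_smul, SchwartzMap.fourier_coe, Real.fourier_eq]
    simp [VectorFourier.fourierIntegral, inner_smul_right]
  have e2 : ∀ y, testFourier φ (s • y) = VectorFourier.fourierIntegral Real.fourierChar volume
      (((2 * Real.pi)⁻¹ * s) • innerₗ E).flip φ y := by
    intro y
    rw [testFourier_eq_fourier, smul_smul, SchwartzMap.fourier_coe, Real.fourier_eq]
    simp [VectorFourier.fourierIntegral, inner_smul_right, real_inner_comm y]
  simp_rw [e1, e2]
  simpa using key

theorem integral_testFourier_smul_mul' (h φ : 𝓢(E, ℂ)) {s : ℝ} (hs : 0 < s) :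
    ∫ y, testFourier h (s • y) * φ y =
      ((s ^ Module.finrank ℝ E)⁻¹ : ℝ) • ∫ x, h (s⁻¹ • x) * testFourier φ x := by
  rw [integral_testFourier_smul_mul]
  have := Measure.integral_comp_smul (volume : Measure E)
    (fun x => h (s⁻¹ • x) * testFourier φ x) s
  rw [abs_of_pos (by positivity)] at this
  rw [← this]
  simp_rw [smul_smul, inv_mul_cancel₀ hs.ne', one_smul]

/-- Near the origin `‖x‖^{-α}` is integrable because `α` is below the dimension; outside the unit
ball it is at most 1 and `φ` is integrable. -/
theorem integrable_mul_schwartz_of_norm_le_rpow {u : E → ℂ} {C α : ℝ} (hα0 : 0 ≤ α)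
    (hα : α < Module.finrank ℝ E) (hu : AEStronglyMeasurable u)
    (hC : ∀ x ≠ 0, ‖u x‖ ≤ C * ‖x‖ ^ (-α)) (φ : 𝓢(E, ℂ)) : Integrable (fun x => u x * φ x) := by
  have hd : 1 ≤ Module.finrank ℝ E := by
    have : (0 : ℝ) < Module.finrank ℝ E := by linarith
    exact_mod_cast this
  have : Nontrivial E := Module.nontrivial_of_finrank_pos (R := ℝ) hd
  have hne : ∀ᵐ x : E, x ≠ 0 := by simp [ae_iff]
  obtain ⟨D, hD0, hD⟩ := φ.decay 0 0
  have hD' : ∀ x, ‖φ x‖ ≤ D := fun x => by simpa using hD x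
  have h1 : IntegrableOn (fun x => u x * φ x) (Metric.ball 0 1) := by
    refine integrableOn_ball_of_norm_le_rpow (C := C * D) hd hα ?_
      (hu.mul φ.continuous.aestronglyMeasurable)
    filter_upwards [ae_restrict_of_ae hne] with x hx
    rw [norm_mul]
    calc ‖u x‖ * ‖φ x‖ ≤ (C * ‖x‖ ^ (-α)) * D := by
          gcongr
          · exact (norm_nonneg _).trans (hC x hx)
          · exact hC x hx
          · exact hD' x
      _ = C * D * ‖x‖ ^ (-α) := by ring
  have h2 : IntegrableOn (fun x => u x * φ x) (Metric.ball 0 1)ᶜ := by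
    refine Integrable.mono' (g := fun x => |C| * ‖φ x‖)
      (φ.integrable.norm.const_mul _).integrableOn
      (hu.mul φ.continuous.aestronglyMeasurable).restrict ?_
    refine (ae_restrict_mem Metric.isOpen_ball.measurableSet.compl).mono fun x hx => ?_
    have hx1 : 1 ≤ ‖x‖ := by simpa using hx
    have hx0 : x ≠ 0 := by rintro rfl; simp at hx1; linarith
    rw [norm_mul]
    gcongr
    refine (hC x hx0).trans ?_
    have h3 : ‖x‖ ^ (-α) ≤ 1 := Real.rpow_le_one_of_one_le_of_nonpos hx1 (by linarith)
    have h4 : 0 ≤ ‖x‖ ^ (-α) := by positivity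
    nlinarith [le_abs_self C, abs_nonneg C]
  rw [← integrableOn_univ, ← union_compl_self (Metric.ball (0 : E) 1)]
  exact h1.union h2

end Fourier

/-! ### Homogeneity of Mellin integrals along a ray -/

section Scaling

variable {F : Type*} [NormedAddCommGroup F] [NormedSpace ℝ F]

theorem integral_pow_smul_comp_mul (B : ℝ → F) {q : ℕ} (hq : 1 ≤ q) {r : ℝ} (hr : 0 < r) :
    ∫ s in Ioi (0 : ℝ), s ^ (q - 1) • B (s * r) =
      (r ^ q)⁻¹ • ∫ s in Ioi (0 : ℝ), s ^ (q - 1) • B s := by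
  have := integral_comp_mul_right_Ioi (fun s => s ^ (q - 1) • B s) 0 hr
  rw [zero_mul] at this
  simp_rw [mul_pow, mul_comm _ (r ^ (q - 1)), mul_smul] at this
  rw [integral_smul] at this
  obtain ⟨m, rfl⟩ : ∃ m, q = m + 1 := ⟨q - 1, by omega⟩
  simp only [Nat.add_sub_cancel] at this ⊢
  rw [pow_succ, mul_inv, mul_smul, ← this, smul_smul, inv_mul_cancel₀ (by positivity), one_smul]

theorem integrableOn_pow_smul_comp_mul {B : ℝ → F} {q : ℕ}
    (hB : IntegrableOn (fun s : ℝ => s ^ (q - 1) • B s) (Ioi 0)) {r : ℝ} (hr : 0 < r) :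
    IntegrableOn (fun s : ℝ => s ^ (q - 1) • B (s * r)) (Ioi 0) := by
  have := (integrableOn_Ioi_comp_mul_right_iff (fun s => s ^ (q - 1) • B s) 0 hr).2
    (by simpa using hB)
  refine IntegrableOn.congr_fun (this.smul ((r ^ (q - 1))⁻¹)) (fun s _ => ?_) measurableSet_Ioi
  simp only [Pi.smul_apply, smul_smul, mul_pow]
  congr 1
  have : r ^ (q - 1) ≠ 0 := by positivity
  field_simp

end Scaling

theorem exists_norm_schwartz_le {E : Type*} [NormedAddCommGroup E] [NormedSpace ℝ E]
    (φ : 𝓢(E, ℂ)) (m : ℕ) :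
    ∃ C : ℝ, 0 ≤ C ∧ ∀ x, ‖φ x‖ ≤ C * ((1 + ‖x‖) ^ m)⁻¹ := by
  refine ⟨2 ^ m * (Finset.Iic (m, 0)).sup (fun m => SchwartzMap.seminorm ℝ m.1 m.2) φ,
    by positivity, fun x => ?_⟩
  have := SchwartzMap.one_add_le_sup_seminorm_apply (𝕜 := ℝ) (m := (m, 0)) le_rfl le_rfl φ x
  simp only [norm_iteratedFDeriv_zero] at this
  rw [← div_eq_mul_inv, le_div_iff₀ (by positivity)]
  linarith

/-- Supplies the dominating function for all radial integrals: decay of order `q + 1` beats the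
weight `s^{q-1}` with `(1 + s²)⁻¹` to spare. -/
theorem integrableOn_pow_mul_inv_one_add_pow {q : ℕ} (hq : 1 ≤ q) (C : ℝ) :
    IntegrableOn (fun s : ℝ => s ^ (q - 1) • (C * ((1 + s) ^ (q + 1))⁻¹)) (Ioi 0) := by
  have : IntegrableOn (fun s : ℝ => |C| * (1 + s ^ 2)⁻¹) (Ioi 0) :=
    (integrable_inv_one_add_sq.const_mul _).integrableOn
  refine Integrable.mono' this (by fun_prop) ?_
  refine (ae_restrict_mem measurableSet_Ioi).mono fun s (hs : 0 < s) => ?_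
  rw [norm_smul, norm_mul, Real.norm_eq_abs C, Real.norm_of_nonneg (by positivity),
    Real.norm_of_nonneg (by positivity), mul_left_comm]
  gcongr
  obtain ⟨m, rfl⟩ : ∃ m, q = m + 1 := ⟨q - 1, by omega⟩
  rw [← div_eq_mul_inv, div_le_iff₀ (by positivity), inv_mul_eq_div, le_div_iff₀ (by positivity)]
  simp only [Nat.add_sub_cancel]
  calc s ^ m * (1 + s ^ 2) ≤ (1 + s) ^ m * (1 + s) ^ 2 := by
        gcongr
        · linarith
        · nlinarith
    _ = _ := by ring

/-! ### Fourier transform of a superposition of dilates -/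

section RadialFourier

variable {E : Type*} [NormedAddCommGroup E] [InnerProductSpace ℝ E] [FiniteDimensional ℝ E]
  [MeasurableSpace E] [BorelSpace E]

/-- The Mellin-type integral `∫₀^∞ s^{q-1} ĥ(sξ) ds` of the Fourier transform of `h` along the ray
through `ξ`. -/
noncomputable def radialFourier (q : ℕ) (h : 𝓢(E, ℂ)) (ξ : E) : ℂ :=
  ∫ s in Ioi (0 : ℝ), s ^ (q - 1) • testFourier h (s • ξ)

theorem exists_norm_testFourier_le (h : 𝓢(E, ℂ)) (m : ℕ) :
    ∃ C : ℝ, 0 ≤ C ∧ ∀ x, ‖testFourier h x‖ ≤ C * ((1 + ‖x‖) ^ m)⁻¹ := by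
  obtain ⟨ψ, hψ⟩ := exists_schwartzMap_eq_testFourier h
  simpa only [hψ] using exists_norm_schwartz_le ψ m

theorem exists_norm_radialFourier_le {q : ℕ} (hq : 1 ≤ q) (h : 𝓢(E, ℂ)) :
    ∃ C : ℝ, ∀ ξ ≠ 0, ‖radialFourier q h ξ‖ ≤ C * ‖ξ‖ ^ (-(q : ℝ)) := by
  obtain ⟨C, hC0, hC⟩ := exists_norm_testFourier_le h (q + 1)
  refine ⟨∫ s in Ioi (0 : ℝ), s ^ (q - 1) • (C * ((1 + s) ^ (q + 1))⁻¹), fun ξ hξ => ?_⟩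
  have hpos : 0 < ‖ξ‖ := norm_pos_iff.2 hξ
  rw [Real.rpow_neg hpos.le, Real.rpow_natCast, mul_comm, ← smul_eq_mul,
    ← integral_pow_smul_comp_mul (fun s => C * ((1 + s) ^ (q + 1))⁻¹) hq hpos]
  refine norm_integral_le_of_norm_le
    (integrableOn_pow_smul_comp_mul (integrableOn_pow_mul_inv_one_add_pow hq C) hpos) ?_
  refine (ae_restrict_mem measurableSet_Ioi).mono fun s (hs : 0 < s) => ?_
  rw [norm_smul, Real.norm_of_nonneg (by positivity), smul_eq_mul]
  gcongr
  simpa [norm_smul, abs_of_pos hs] using hC (s • ξ)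

theorem continuousOn_radialFourier {q : ℕ} (hq : 1 ≤ q) (h : 𝓢(E, ℂ)) :
    ContinuousOn (radialFourier q h) {0}ᶜ := by
  obtain ⟨C, hC0, hC⟩ := exists_norm_testFourier_le h (q + 1)
  have hcont := continuous_testFourier h
  intro ξ₀ hξ₀
  have hpos : 0 < ‖ξ₀‖ / 2 := half_pos (norm_pos_iff.2 hξ₀)
  refine ContinuousAt.continuousWithinAt ?_
  refine continuousAt_of_dominated
    (bound := fun s : ℝ => s ^ (q - 1) • (C * ((1 + s * (‖ξ₀‖ / 2)) ^ (q + 1))⁻¹)) ?_ ?_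
    (integrableOn_pow_smul_comp_mul (integrableOn_pow_mul_inv_one_add_pow hq C) hpos) ?_
  · exact Filter.Eventually.of_forall fun ξ => by fun_prop
  -- Near `ξ₀` the norm stays above `‖ξ₀‖ / 2`, so a single bound dominates along all these rays.
  · have : ∀ᶠ ξ in nhds ξ₀, ‖ξ₀‖ / 2 < ‖ξ‖ :=
      continuous_norm.continuousAt.eventually_const_lt (by linarith)
    filter_upwards [this] with ξ hξ
    refine (ae_restrict_mem measurableSet_Ioi).mono fun s (hs : 0 < s) => ?_
    rw [norm_smul, Real.norm_of_nonneg (by positivity), smul_eq_mul]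
    gcongr
    refine (hC (s • ξ)).trans ?_
    rw [norm_smul, Real.norm_of_nonneg hs.le]
    gcongr
  · exact Filter.Eventually.of_forall fun s => by fun_prop

theorem aestronglyMeasurable_of_continuousOn_compl_zero {F : Type*} [NormedAddCommGroup F]
    [SecondCountableTopology F] [Nontrivial E]
    {u : E → F} (hu : ContinuousOn u {0}ᶜ) : AEStronglyMeasurable u := by
  have h1 : AEStronglyMeasurable u (volume.restrict {0}ᶜ) :=
    hu.aestronglyMeasurable (measurableSet_singleton 0).compl
  rwa [restrict_compl_singleton] at h1

theorem integral_radialFourier_mul {q : ℕ} (hq : 1 ≤ q) (hqd : q < Module.finrank ℝ E)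
    (h φ : 𝓢(E, ℂ)) :
    ∫ ξ, radialFourier q h ξ * φ ξ =
      ∫ s in Ioi (0 : ℝ), s ^ (q - 1) • ∫ ξ, testFourier h (s • ξ) * φ ξ := by
  have : Nontrivial E := Module.nontrivial_of_finrank_pos (R := ℝ) (by omega)
  have hne : ∀ᵐ x : E, x ≠ 0 := by simp [ae_iff]
  obtain ⟨C, hC0, hC⟩ := exists_norm_testFourier_le h (q + 1)
  have hcont := continuous_testFourier h
  set b : ℝ → ℝ := fun s => C * ((1 + s) ^ (q + 1))⁻¹ with hb
  set I : ℝ := ∫ s in Ioi (0 : ℝ), s ^ (q - 1) • b s with hI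
  have hbint := integrableOn_pow_mul_inv_one_add_pow hq C
  -- Absolute integrability for Fubini: integrating the bound over `s` first leaves `I ‖x‖^{-q} ‖φ
  -- x‖`, which is integrable since `q` is below the dimension.
  have hdom : Integrable (fun z : E × ℝ => (z.2 ^ (q - 1) • b (z.2 * ‖z.1‖)) * ‖φ z.1‖)
      (volume.prod (volume.restrict (Ioi 0))) := by
    have hm : AEStronglyMeasurable
        (fun z : E × ℝ => (z.2 ^ (q - 1) • b (z.2 * ‖z.1‖)) * ‖φ z.1‖)
        (volume.prod (volume.restrict (Ioi 0))) := by
      have : Measurable b := by fun_prop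
      have := φ.continuous.measurable
      exact Measurable.aestronglyMeasurable (by fun_prop)
    rw [integrable_prod_iff hm]
    constructor
    · filter_upwards [hne] with x hx
      exact (integrableOn_pow_smul_comp_mul hbint (norm_pos_iff.2 hx)).mul_const _
    · have h1 : Integrable (fun x : E => ((I * ‖x‖ ^ (-(q : ℝ)) : ℝ) : ℂ) * φ x) := by
        refine integrable_mul_schwartz_of_norm_le_rpow (C := |I|) (α := q) (by positivity)
          (by exact_mod_cast hqd) ?_ (fun x _ => ?_) φ
        · exact Measurable.aestronglyMeasurable (by fun_prop)
        · rw [Complex.norm_real, norm_mul, Real.norm_eq_abs I,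
            Real.norm_of_nonneg (by positivity)]
      refine h1.norm.congr ?_
      filter_upwards [hne] with x hx
      have hpos : 0 < ‖x‖ := norm_pos_iff.2 hx
      have hnn : 0 ≤ I := setIntegral_nonneg measurableSet_Ioi fun s (hs : 0 < s) => by
        simp only [hb, smul_eq_mul]; positivity
      rw [norm_mul, Complex.norm_real, Real.norm_of_nonneg (by positivity),
        Real.rpow_neg hpos.le, Real.rpow_natCast, mul_comm I, ← smul_eq_mul (_⁻¹), hI,
        ← integral_pow_smul_comp_mul b hq hpos, ← integral_mul_const]
      refine setIntegral_congr_fun measurableSet_Ioi fun s (hs : 0 < s) => ?_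
      simp only [hb, smul_eq_mul]
      rw [Real.norm_of_nonneg (by positivity)]
  have hint : Integrable (fun z : E × ℝ => (z.2 ^ (q - 1) • testFourier h (z.2 • z.1)) * φ z.1)
      (volume.prod (volume.restrict (Ioi 0))) := by
    have := φ.continuous
    refine hdom.mono' (Continuous.aestronglyMeasurable (by fun_prop)) ?_
    have h2 : ∀ᵐ z : E × ℝ ∂(volume.prod (volume.restrict (Ioi 0))), z.2 ∈ Ioi (0 : ℝ) :=
      Measure.quasiMeasurePreserving_snd.ae (ae_restrict_mem measurableSet_Ioi)
    filter_upwards [h2] with z (hz : 0 < z.2)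
    rw [norm_mul, norm_smul, Real.norm_of_nonneg (by positivity), smul_eq_mul]
    gcongr
    simpa [norm_smul, abs_of_pos hz] using hC (z.2 • z.1)
  calc ∫ ξ, radialFourier q h ξ * φ ξ
      = ∫ ξ, ∫ s in Ioi (0 : ℝ), (s ^ (q - 1) • testFourier h (s • ξ)) * φ ξ := by
        simp_rw [radialFourier, ← integral_mul_const]
    _ = ∫ s in Ioi (0 : ℝ), ∫ ξ, (s ^ (q - 1) • testFourier h (s • ξ)) * φ ξ :=
        integral_integral_swap hint
    _ = _ := by simp_rw [smul_mul_assoc, integral_smul]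

/-- A superposition `c ∫₀^∞ s^{-p-1} h(x/s) ds` of dilates of a test function has the Fourier
transform `c ∫₀^∞ s^{q-1} ĥ(sξ) ds`, where `p + q` is the dimension. -/
theorem isFourierTransform_radialFourier {p q : ℕ} (hp : 1 ≤ p) (hq : 1 ≤ q)
    (hpq : p + q = Module.finrank ℝ E) {f : E → ℝ} {C c : ℝ} (h : 𝓢(E, ℂ)) {h₀ : E → ℝ}
    (hh : ∀ x, h x = (h₀ x : ℂ)) (hh₀ : ∀ x, 0 ≤ h₀ x) (hc : 0 < c)
    (hf : ContinuousOn f {0}ᶜ) (hfC : ∀ x ≠ 0, f x ≤ C * ‖x‖ ^ (-(p : ℝ)))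
    (hfpos : ∀ x ≠ 0, 0 < f x)
    (hfh : ∀ x ≠ 0, f x = c * ∫ s in Ioi (0 : ℝ), (s ^ (p + 1))⁻¹ * h₀ (s⁻¹ • x)) :
    IsFourierTransform f (fun ξ => c * radialFourier q h ξ) := by
  have : Nontrivial E := Module.nontrivial_of_finrank_pos (R := ℝ) (by omega)
  have hne : ∀ᵐ x : E, x ≠ 0 := by simp [ae_iff]
  have hfint : ∀ φ : 𝓢(E, ℂ), Integrable (fun x => (f x : ℂ) * φ x) := fun φ => by
    refine integrable_mul_schwartz_of_norm_le_rpow (C := C) (α := p) (by positivity)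
      (by rw [← hpq]; push_cast; have : (1 : ℝ) ≤ q := by exact_mod_cast hq
          linarith) ?_ (fun x hx => ?_) φ
    · exact Complex.continuous_ofReal.comp_aestronglyMeasurable
        (aestronglyMeasurable_of_continuousOn_compl_zero hf)
    · rw [Complex.norm_real, Real.norm_of_nonneg (hfpos x hx).le]
      exact hfC x hx
  have hgc := continuousOn_radialFourier hq h
  refine ⟨hfint, fun φ => ?_, fun φ => ?_, continuousOn_const.mul hgc⟩
  · obtain ⟨D, hD⟩ := exists_norm_radialFourier_le hq h
    have := integrable_mul_schwartz_of_norm_le_rpow (C := D) (α := q) (by positivity)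
      (by rw [← hpq]; push_cast; have : (1 : ℝ) ≤ p := by exact_mod_cast hp
          linarith) (aestronglyMeasurable_of_continuousOn_compl_zero hgc) hD φ
    simpa only [mul_assoc] using this.const_mul (c : ℂ)
  obtain ⟨ψ, hψ⟩ := exists_schwartzMap_eq_testFourier φ
  have hcont : Continuous h₀ := by
    have : h₀ = fun x => (h x).re := by ext x; simp [hh]
    rw [this]
    exact Complex.continuous_re.comp h.continuous
  -- A non-integrable function has integral 0 by convention, which the positivity of `f` rules out.
  have hsint : ∀ x ≠ 0, IntegrableOn (fun s : ℝ => (s ^ (p + 1))⁻¹ * h₀ (s⁻¹ • x)) (Ioi 0) := by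
    intro x hx
    by_contra hcon
    have h1 := hfpos x hx
    rw [hfh x hx, integral_undef hcon, mul_zero] at h1
    exact lt_irrefl _ h1
  have hint : Integrable
      (fun z : E × ℝ => (((z.2 ^ (p + 1))⁻¹ * h₀ (z.2⁻¹ • z.1) : ℝ) : ℂ) * ψ z.1)
      (volume.prod (volume.restrict (Ioi 0))) := by
    have hm : AEStronglyMeasurable
      (fun z : E × ℝ => (((z.2 ^ (p + 1))⁻¹ * h₀ (z.2⁻¹ • z.1) : ℝ) : ℂ) * ψ z.1)
      (volume.prod (volume.restrict (Ioi 0))) := by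
      have := hcont.measurable
      have := ψ.continuous.measurable
      exact Measurable.aestronglyMeasurable (by fun_prop)
    rw [integrable_prod_iff hm]
    constructor
    · filter_upwards [hne] with x hx
      exact ((hsint x hx).ofReal).mul_const _
    · refine ((hfint ψ).norm.const_mul c⁻¹).congr ?_
      filter_upwards [hne] with x hx
      rw [norm_mul, Complex.norm_real, Real.norm_of_nonneg (hfpos x hx).le, hfh x hx, ← mul_assoc,
        ← mul_assoc, inv_mul_cancel₀ hc.ne', one_mul, ← integral_mul_const]
      refine setIntegral_congr_fun measurableSet_Ioi fun s (hs : 0 < s) => ?_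
      have := hh₀ (s⁻¹ • x)
      rw [norm_mul, Complex.norm_real, Real.norm_of_nonneg (by positivity)]
  have hR : ∫ x, (f x : ℂ) * testFourier φ x =
      c * ∫ s in Ioi (0 : ℝ), ∫ x, (((s ^ (p + 1))⁻¹ * h₀ (s⁻¹ • x) : ℝ) : ℂ) * ψ x := by
    rw [← integral_integral_swap hint, ← integral_const_mul]
    refine integral_congr_ae ?_
    filter_upwards [hne] with x hx
    rw [hfh x hx, ← hψ, integral_mul_const, integral_complex_ofReal]
    push_cast
    ring
  rw [hR]
  simp_rw [mul_assoc]
  rw [integral_const_mul, integral_radialFourier_mul hq (by omega)]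
  congr 1
  refine setIntegral_congr_fun measurableSet_Ioi fun s (hs : 0 < s) => ?_
  rw [integral_testFourier_smul_mul' h φ hs, smul_smul, ← integral_smul]
  congr 1 with x
  rw [hh, hψ, Complex.real_smul]
  -- The Jacobian of the dilation accounts for the exponents: `(q - 1) - (p + q) = -(p + 1)`.
  have : s ^ (q - 1) * (s ^ Module.finrank ℝ E)⁻¹ = (s ^ (p + 1))⁻¹ := by
    rw [← hpq, mul_inv_eq_iff_eq_mul₀ (by positivity), inv_mul_eq_div,
      eq_div_iff (by positivity), ← pow_add]
    congr 1
    omega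
  rw [this]
  push_cast
  ring

end RadialFourier

/-! ### Integrals of a Fourier transform over a subspace -/

section Section

variable {E V W : Type*} [NormedAddCommGroup E] [InnerProductSpace ℝ E] [FiniteDimensional ℝ E]
  [MeasurableSpace E] [BorelSpace E]
  [NormedAddCommGroup V] [InnerProductSpace ℝ V] [FiniteDimensional ℝ V]
  [MeasurableSpace V] [BorelSpace V]
  [NormedAddCommGroup W] [InnerProductSpace ℝ W] [FiniteDimensional ℝ W]
  [MeasurableSpace W] [BorelSpace W]

/-- The isometry `(v, w) ↦ ι v + j w` onto the ambient space, for two orthogonal isometric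
embeddings of complementary dimensions. -/
noncomputable def orthogonalSumEquiv (ι : V →ₗᵢ[ℝ] E) (j : W →ₗᵢ[ℝ] E)
    (hij : ∀ v w, ⟪ι v, j w⟫ = 0)
    (hd : Module.finrank ℝ V + Module.finrank ℝ W = Module.finrank ℝ E) :
    WithLp 2 (V × W) ≃ₗᵢ[ℝ] E :=
  LinearIsometry.toLinearIsometryEquiv
    { toLinearMap := (ι.toLinearMap.coprod j.toLinearMap) ∘ₗ
        (WithLp.linearEquiv 2 ℝ (V × W)).toLinearMap
      norm_map' := fun z => by
        have h1 : ‖ι z.fst + j z.snd‖ * ‖ι z.fst + j z.snd‖ = ‖z‖ * ‖z‖ := by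
          rw [norm_add_sq_eq_norm_sq_add_norm_sq_real (hij _ _), ι.norm_map, j.norm_map,
            ← sq, ← sq, ← sq, WithLp.prod_norm_sq_eq_of_L2]
        exact (mul_self_inj (norm_nonneg _) (norm_nonneg _)).1 h1 }
    (by rw [(WithLp.linearEquiv 2 ℝ (V × W)).finrank_eq, Module.finrank_prod, hd])

theorem measurePreserving_orthogonalSum (ι : V →ₗᵢ[ℝ] E) (j : W →ₗᵢ[ℝ] E)
    (hij : ∀ v w, ⟪ι v, j w⟫ = 0)
    (hd : Module.finrank ℝ V + Module.finrank ℝ W = Module.finrank ℝ E) :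
    MeasurePreserving (fun z : V × W => ι z.1 + j z.2) :=
  (orthogonalSumEquiv ι j hij hd).measurePreserving.comp (WithLp.volume_preserving_toLp V W)

theorem measurableEmbedding_orthogonalSum (ι : V →ₗᵢ[ℝ] E) (j : W →ₗᵢ[ℝ] E)
    (hij : ∀ v w, ⟪ι v, j w⟫ = 0)
    (hd : Module.finrank ℝ V + Module.finrank ℝ W = Module.finrank ℝ E) :
    MeasurableEmbedding (fun z : V × W => ι z.1 + j z.2) :=
  (orthogonalSumEquiv ι j hij hd).toHomeomorph.measurableEmbedding.comp
    (MeasurableEquiv.toLp 2 (V × W)).measurableEmbedding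

/-- The integral of the Fourier transform over a subspace is the integral of the function over the
orthogonal complement. -/
theorem integral_fourier_comp_isometry (ι : V →ₗᵢ[ℝ] E) (j : W →ₗᵢ[ℝ] E)
    (hij : ∀ v w, ⟪ι v, j w⟫ = 0)
    (hd : Module.finrank ℝ V + Module.finrank ℝ W = Module.finrank ℝ E) (h : 𝓢(E, ℂ)) :
    ∫ v, 𝓕 h (ι v) = ∫ w, h (j w) := by
  have hmp := measurePreserving_orthogonalSum ι j hij hd
  have hme := measurableEmbedding_orthogonalSum ι j hij hd
  have hnorm : ∀ v w, ‖w‖ ≤ ‖ι v + j w‖ := fun v w => by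
    have := norm_add_sq_eq_norm_sq_add_norm_sq_real (hij v w)
    rw [j.norm_map] at this
    exact abs_le_of_sq_le_sq' (by nlinarith [norm_nonneg (ι v)]) (norm_nonneg _) |>.2
  -- The marginal of `h` along `W`. Its Fourier transform on `V` is the restriction of `𝓕 h`, so the
  -- claim is Fourier inversion for `A` at the origin.
  set A : V → ℂ := fun v => ∫ w, h (ι v + j w) with hA
  have hint : Integrable (fun z : V × W => h (ι z.1 + j z.2)) (volume.prod volume) :=
    (hmp.integrable_comp_emb hme).2 h.integrable
  have hAint : Integrable A := hint.integral_prod_left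
  have hAcont : Continuous A := by
    -- By Pythagoras the decay of `h` in `w` is uniform in `v`; one power more than the dimension
    -- makes the bound integrable.
    obtain ⟨C, hC0, hC⟩ := exists_norm_schwartz_le h (Module.finrank ℝ W + 1)
    refine continuous_of_dominated (bound := fun w => C * ((1 + ‖w‖) ^ (Module.finrank ℝ W + 1))⁻¹)
      (fun v => ?_) (fun v => ?_) ?_ ?_
    · have := h.continuous
      exact Continuous.aestronglyMeasurable (by fun_prop)
    · refine Filter.Eventually.of_forall fun w => (hC _).trans ?_
      gcongr
      exact hnorm v w
    · have : Integrable fun w : W => (1 + ‖w‖) ^ (-((Module.finrank ℝ W + 1 : ℕ) : ℝ)) :=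
        integrable_one_add_norm (by push_cast; linarith)
      refine (this.const_mul C).congr (Filter.Eventually.of_forall fun w => ?_)
      simp only
      rw [Real.rpow_neg (by positivity), Real.rpow_natCast]
    · have := h.continuous
      exact Filter.Eventually.of_forall fun w => by fun_prop
  have hF : 𝓕 A = fun v => 𝓕 h (ι v) := by
    ext u
    rw [SchwartzMap.fourier_coe, Real.fourier_eq, Real.fourier_eq,
      ← hmp.integral_comp hme]
    have hint' : Integrable (fun z : V × W =>
        Real.fourierChar (-⟪ι z.1 + j z.2, ι u⟫) • h (ι z.1 + j z.2)) (volume.prod volume) := by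
      have h1 : Integrable (fun x : E => Real.fourierChar (-⟪x, ι u⟫) • h x) := by
        have := (Real.fourierIntegral_convergent_iff (μ := volume) (f := h) (ι u)).2 h.integrable
        simpa using this
      exact (hmp.integrable_comp_emb hme).2 h1
    rw [Measure.volume_eq_prod, integral_prod _ hint']
    congr 1 with v
    simp_rw [hA, inner_add_left, ι.inner_map_map, real_inner_comm (ι u), hij, add_zero]
    simp_rw [Circle.smul_def]
    exact (integral_smul _ _).symm
  have hFint : Integrable (𝓕 A) := by
    rw [hF]
    obtain ⟨C, hC0, hC⟩ := exists_norm_schwartz_le (𝓕 h) (Module.finrank ℝ V + 1)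
    have h1 : Integrable fun v : V => (1 + ‖v‖) ^ (-((Module.finrank ℝ V + 1 : ℕ) : ℝ)) :=
      integrable_one_add_norm (by push_cast; linarith)
    refine (h1.const_mul C).mono' ?_ (Filter.Eventually.of_forall fun v => ?_)
    · have := (𝓕 h).continuous
      exact Continuous.aestronglyMeasurable (by fun_prop)
    · rw [Real.rpow_neg (by positivity), Real.rpow_natCast, ← ι.norm_map v]
      exact hC _
  have key := congrFun (hAcont.fourierInv_fourier_eq hAint hFint) 0
  rw [Real.fourierInv_eq, hF] at key
  simpa [hA] using key

theorem integral_testFourier_comp_isometry (ι : V →ₗᵢ[ℝ] E) (j : W →ₗᵢ[ℝ] E)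
    (hij : ∀ v w, ⟪ι v, j w⟫ = 0)
    (hd : Module.finrank ℝ V + Module.finrank ℝ W = Module.finrank ℝ E) (h : 𝓢(E, ℂ)) :
    ∫ v, testFourier h (ι v) = ((2 * Real.pi) ^ Module.finrank ℝ V : ℝ) • ∫ w, h (j w) := by
  -- The factor `(2π)^{dim V}` is the Jacobian of passing from `e^{-2πi⟨x,y⟩}` to `e^{-i⟨x,y⟩}`.
  have := Measure.integral_comp_smul (volume : Measure V) (fun v => 𝓕 h (ι v)) (2 * Real.pi)⁻¹
  rw [abs_of_pos (by positivity), inv_pow, inv_inv,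
    integral_fourier_comp_isometry ι j hij hd] at this
  rw [← this]
  simp_rw [testFourier_eq_fourier, map_smul]

end Section

/-! ### Polar coordinates for an arbitrary norm -/

section Polar

open Module

variable {E : Type*} [AddCommGroup E] [Module ℝ E] [FiniteDimensional ℝ E] [mE : MeasurableSpace E]
  [tE : TopologicalSpace E] [IsTopologicalAddGroup E] [BorelSpace E] [T2Space E]
  [ContinuousSMul ℝ E] [Nontrivial E] (μ : Measure E) [μ.IsAddHaarMeasure] {g : E → ℝ}

/-- Integration in polar coordinates of a function of a norm `g`, not necessarily the one of the
space. -/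
theorem integral_comp_norm_like (h1 : g 0 = 0)
    (h2 : ∀ x, g (-x) = g x) (h3 : ∀ x y, g (x + y) ≤ g x + g y) (h4 : ∀ {x}, g x = 0 → x = 0)
    (h5 : ∀ r x, g (r • x) ≤ |r| * (g x)) (η : ℝ → ℝ) :
    ∫ x, η (g x) ∂μ = finrank ℝ E • μ.real {x | g x < 1} •
      ∫ y in Ioi (0 : ℝ), y ^ (finrank ℝ E - 1) • η y := by
  -- A copy of `E` normed by `g`: the identity is a homeomorphism in finite dimension, so the usual
  -- polar formula on `F` transfers back.
  let F : Type _ := E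
  let p : AddGroupNorm F := ⟨⟨g, h1, h3, h2⟩, fun x hx ↦ h4 hx⟩
  let : NormedAddCommGroup F := AddGroupNorm.toNormedAddCommGroup p
  let : NormedSpace ℝ F := { norm_smul_le := fun _ _ ↦ h5 _ _ }
  let : TopologicalSpace F := UniformSpace.toTopologicalSpace
  let : MeasurableSpace F := borel F
  have : BorelSpace F := { measurable_eq := rfl }
  let φ := @LinearEquiv.toContinuousLinearEquiv ℝ _ E _ _ tE _ _ F _ _ _ _ _ _ _ _ _
    (LinearEquiv.refl ℝ E : E ≃ₗ[ℝ] F)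
  let ν : Measure F := @Measure.map E F mE _ φ μ
  have hφ : @Measurable E F mE _ φ := by
    refine @Continuous.measurable E F tE mE _ _ _ _ φ ?_
    exact @ContinuousLinearEquiv.continuous ℝ ℝ _ _ _ _ _ _ E tE _ F _ _ _ _ φ
  have hball : ν.real (Metric.ball 0 1) = μ.real {x | g x < 1} := by
    rw [Measure.real, Measure.real, @Measure.map_apply E F mE _ μ φ hφ _ measurableSet_ball]
    congr!
    simp_rw [Metric.ball, dist_zero_right]
    rfl
  let ψ := @Homeomorph.toMeasurableEquiv E F tE mE _ _ _ _
    (@ContinuousLinearEquiv.toHomeomorph ℝ ℝ _ _ _ _ _ _ E tE _ F _ _ _ _ φ)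
  have hψ : @MeasurePreserving E F mE _ ψ μ ν :=
    @Measurable.measurePreserving E F mE _ ψ (@MeasurableEquiv.measurable E F mE _ ψ) _
  have : Nontrivial F := ‹Nontrivial E›
  have key := integral_fun_norm_addHaar ν η
  rw [hball, ← hψ.integral_comp'] at key
  exact key

end Polar

/-! ### The gauge of a symmetric convex body -/

section Gauge

variable {E : Type*} [NormedAddCommGroup E] [NormedSpace ℝ E] {K : Set E}

theorem mem_nhds_zero_of_symmetric (hconv : Convex ℝ K) (hint : (interior K).Nonempty)
    (hsymm : ∀ x ∈ K, -x ∈ K) : K ∈ nhds (0 : E) := by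
  obtain ⟨x, hx⟩ := hint
  have hx' : -x ∈ interior K := by
    refine interior_maximal (s := K) (t := Neg.neg ⁻¹' interior K) (fun y hy => ?_)
      (isOpen_interior.preimage continuous_neg) (by simpa using hx)
    simpa using hsymm _ (interior_subset hy)
  have := hconv.interior hx hx' (by norm_num : (0 : ℝ) ≤ 1 / 2) (by norm_num : (0 : ℝ) ≤ 1 / 2)
    (by norm_num)
  rw [smul_neg, add_neg_cancel] at this
  exact mem_interior_iff_mem_nhds.1 this

theorem gauge_smul_of_symmetric (hsymm : ∀ x ∈ K, -x ∈ K) (r : ℝ) (x : E) :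
    gauge K (r • x) = |r| * gauge K x := by
  rcases le_total 0 r with hr | hr
  · rw [gauge_smul_of_nonneg hr, abs_of_nonneg hr, smul_eq_mul]
  · rw [← gauge_neg hsymm, ← neg_smul, gauge_smul_of_nonneg (by linarith), abs_of_nonpos hr,
      smul_eq_mul]

theorem gauge_pos_of_ne_zero (hK : K ∈ nhds (0 : E)) (hbdd : Bornology.IsBounded K) {x : E}
    (hx : x ≠ 0) : 0 < gauge K x :=
  (gauge_pos (absorbent_nhds_zero hK) (NormedSpace.isVonNBounded_iff ℝ |>.2 hbdd)).2 hx

theorem exists_mul_norm_le_gauge (hK : K ∈ nhds (0 : E)) (hbdd : Bornology.IsBounded K) :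
    ∃ a > 0, ∀ x, a * ‖x‖ ≤ gauge K x := by
  obtain ⟨r, hr, hKr⟩ := hbdd.subset_closedBall_lt 0 0
  refine ⟨r⁻¹, by positivity, fun x => ?_⟩
  rw [inv_mul_eq_div]
  exact le_gauge_of_subset_closedBall (absorbent_nhds_zero hK) hr.le hKr

end Gauge

/-! ### Smoothness of functions of the gauge -/

section Smooth

variable {E : Type*} [NormedAddCommGroup E] [InnerProductSpace ℝ E] [FiniteDimensional ℝ E]
  {K : Set E}

/-- By homogeneity the gauge is `‖y‖` times its value at `y / ‖y‖`, and radial projection to the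
sphere is smooth off the origin. -/
theorem IsInfinitelySmooth.contDiffAt_gauge [Nontrivial E] (hsm : IsInfinitelySmooth K) {x : E}
    (hx : x ≠ 0) : ContDiffAt ℝ ∞ (gauge K) x := by
  have : Fact (Module.finrank ℝ E = (Module.finrank ℝ E - 1) + 1) :=
    ⟨by have := Module.finrank_pos (R := ℝ) (M := E); omega⟩
  let U : TopologicalSpace.Opens E := ⟨{0}ᶜ, isOpen_compl_singleton⟩
  have hmem : ∀ y : U, ‖(y : E)‖⁻¹ • (y : E) ∈ Metric.sphere (0 : E) 1 := fun y => by
    have : (y : E) ≠ 0 := y.2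
    simp [norm_smul, this]
  have hdir : ContMDiff 𝓘(ℝ, E) 𝓘(ℝ, E) ∞ (fun y : U => ‖(y : E)‖⁻¹ • (y : E)) := by
    intro y
    have hy : (y : E) ≠ 0 := y.2
    refine (contMDiffAt_subtype_iff (f := fun y : E => ‖y‖⁻¹ • y)).2 ?_
    refine ContDiffAt.contMDiffAt ?_
    exact ((contDiffAt_norm ℝ hy).inv (norm_ne_zero_iff.2 hy)).smul contDiffAt_id
  have h1 := (hsm (Module.finrank ℝ E - 1)).comp (hdir.codRestrict_sphere hmem)
  have h2 : ContDiffAt ℝ ∞ (fun y : E => gauge K (‖y‖⁻¹ • y)) x :=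
    ((contMDiffAt_subtype_iff (U := U) (f := fun y : E => gauge K (‖y‖⁻¹ • y))
      (x := ⟨x, hx⟩)).1 (h1 ⟨x, hx⟩)).contDiffAt
  refine ((contDiffAt_norm ℝ hx).mul h2).congr_of_eventuallyEq ?_
  filter_upwards [isOpen_compl_singleton.mem_nhds hx] with y hy
  have hy : y ≠ 0 := hy
  rw [gauge_smul_of_nonneg (by positivity), smul_eq_mul,
    mul_inv_cancel_left₀ (norm_ne_zero_iff.2 hy)]

/-- The gauge need not be smooth at the origin, but `η` vanishes on `t < 1`, so the composition is
zero in a neighbourhood of it. -/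
theorem contDiff_comp_gauge [Nontrivial E] (hsm : IsInfinitelySmooth K) (hK : K ∈ nhds (0 : E))
    {η : ℝ → ℝ} (hη : ContDiff ℝ ∞ η) (hη1 : ∀ t < 1, η t = 0) :
    ContDiff ℝ ∞ (fun x => η (gauge K x)) := by
  refine contDiff_iff_contDiffAt.2 fun x => ?_
  by_cases hx : x = 0
  · subst hx
    refine contDiffAt_const (c := (0 : ℝ)) |>.congr_of_eventuallyEq ?_
    have h0 : ∀ᶠ y in nhds (0 : E), gauge K y < 1 :=
      (tendsto_gauge_nhds_zero hK).eventually_lt_const one_pos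
    filter_upwards [h0] with y hy
    exact hη1 _ hy
  · exact hη.contDiffAt.comp x (hsm.contDiffAt_gauge hx)

theorem hasCompactSupport_comp_gauge (hK : K ∈ nhds (0 : E)) (hbdd : Bornology.IsBounded K)
    {η : ℝ → ℝ} (hη3 : ∀ t, 3 < t → η t = 0) :
    HasCompactSupport (fun x => η (gauge K x)) := by
  obtain ⟨a, ha, hle⟩ := exists_mul_norm_le_gauge hK hbdd
  refine HasCompactSupport.of_support_subset_isCompact
    (isCompact_closedBall (0 : E) (3 / a)) fun x hx => ?_
  rw [mem_closedBall_zero_iff, le_div_iff₀ ha, mul_comm]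
  by_contra! hcon
  exact hx (hη3 _ (hcon.trans_le (hle x)))

end Smooth

/-! ### The bump function and its radial moments -/

section Bump

theorem exists_bump : ∃ η : ℝ → ℝ, ContDiff ℝ ∞ η ∧ (∀ t, 0 ≤ η t) ∧ (∀ t < 1, η t = 0) ∧
    (∀ t, 3 < t → η t = 0) ∧ η 2 = 1 := by
  let b : ContDiffBump (2 : ℝ) := ⟨1 / 2, 1, by norm_num, by norm_num⟩
  refine ⟨b, b.contDiff, fun t => b.nonneg, fun t ht => ?_, fun t ht => ?_,
    b.one_of_mem_closedBall (by simp [b])⟩ <;>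
  · refine b.zero_of_le_dist ?_
    change (1 : ℝ) ≤ |t - 2|
    rw [le_abs]
    first
    | right; linarith
    | left; linarith

theorem integral_pow_mul_bump_pos {η : ℝ → ℝ} (hη : Continuous η) (h0 : ∀ t, 0 ≤ η t)
    (h1 : ∀ t < 1, η t = 0) (h3 : ∀ t, 3 < t → η t = 0) (h2 : η 2 = 1) (m : ℕ) :
    0 < ∫ t in Ioi (0 : ℝ), t ^ m * η t := by
  have hsupp : ∀ t ∉ Ioi (0 : ℝ), t ^ m * η t = 0 := fun t ht => by
    rw [h1 t (by simp at ht; linarith), mul_zero]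
  rw [setIntegral_eq_integral_of_forall_compl_eq_zero hsupp]
  refine Continuous.integral_pos_of_hasCompactSupport_nonneg_nonzero (x := 2) (by fun_prop) ?_ ?_ ?_
  · refine HasCompactSupport.of_support_subset_isCompact (isCompact_Icc (a := (1 : ℝ)) (b := 3))
      fun t ht => ⟨?_, ?_⟩ <;> by_contra! hcon
    · exact ht (by simp [h1 t hcon])
    · exact ht (by simp [h3 t hcon])
  · intro t
    by_cases ht : t ∈ Ioi (0 : ℝ)
    · have : 0 < t := ht
      have := h0 t
      simp only [Pi.zero_apply]
      positivity
    · exact (hsupp t ht).ge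
  · simp [h2]

theorem integral_inv_pow_mul_comp_inv {p : ℕ} (hp : 1 ≤ p) (B : ℝ → ℝ) :
    ∫ s in Ioi (0 : ℝ), (s ^ (p + 1))⁻¹ * B s⁻¹ = ∫ r in Ioi (0 : ℝ), r ^ (p - 1) * B r := by
  rw [← integral_comp_rpow_Ioi (fun r => r ^ (p - 1) * B r) (p := -1) (by norm_num)]
  refine setIntegral_congr_fun measurableSet_Ioi fun s (hs : 0 < s) => ?_
  obtain ⟨m, rfl⟩ : ∃ m, p = m + 1 := ⟨p - 1, by omega⟩
  have : s ^ ((-1 : ℝ) - 1) = (s ^ 2)⁻¹ := by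
    rw [show ((-1 : ℝ) - 1) = -((2 : ℕ) : ℝ) by norm_num, Real.rpow_neg hs.le, Real.rpow_natCast]
  simp only [Nat.add_sub_cancel, smul_eq_mul, Real.rpow_neg_one, abs_neg, abs_one, one_mul, this]
  rw [← mul_assoc, inv_pow, ← mul_inv, ← pow_add]
  congr 3
  omega

theorem integral_inv_pow_mul_comp_inv_mul {p : ℕ} (hp : 1 ≤ p) (η : ℝ → ℝ) {r : ℝ} (hr : 0 < r) :
    ∫ s in Ioi (0 : ℝ), (s ^ (p + 1))⁻¹ * η (s⁻¹ * r) =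
      (r ^ p)⁻¹ * ∫ t in Ioi (0 : ℝ), t ^ (p - 1) * η t := by
  rw [integral_inv_pow_mul_comp_inv hp (fun t => η (t * r))]
  exact integral_pow_smul_comp_mul η hp hr

end Bump

/-! ### Uniqueness of the continuous representative -/

section Uniqueness

variable {E : Type*} [NormedAddCommGroup E] [InnerProductSpace ℝ E] [FiniteDimensional ℝ E]
  [MeasurableSpace E] [BorelSpace E]

/-- Testing against smooth functions compactly supported off the origin gives equality almost
everywhere there, and continuity upgrades it to every point. -/
theorem IsFourierTransform.eqOn_compl_zero {f : E → ℝ} {g₁ g₂ : E → ℂ}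
    (h₁ : IsFourierTransform f g₁) (h₂ : IsFourierTransform f g₂) : EqOn g₁ g₂ {0}ᶜ := by
  have hU : IsOpen ({0}ᶜ : Set E) := isOpen_compl_singleton
  have hae := hU.ae_eq_zero_of_integral_contDiff_smul_eq_zero (μ := volume)
    (f := fun x => g₁ x - g₂ x)
    ((h₁.continuousOn.sub h₂.continuousOn).locallyIntegrableOn hU.measurableSet) ?_
  · refine Measure.eqOn_open_of_ae_eq (μ := volume) ?_ hU h₁.continuousOn h₂.continuousOn
    rw [Filter.EventuallyEq, ae_restrict_iff' hU.measurableSet]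
    filter_upwards [hae] with x hx hxU
    exact sub_eq_zero.1 (hx hxU)
  · intro u hu hsupp _
    have hcs : HasCompactSupport (fun x => (u x : ℂ)) :=
      hsupp.comp_left (g := fun t : ℝ => (t : ℂ)) Complex.ofReal_zero
    let φ : 𝓢(E, ℂ) := hcs.toSchwartzMap (Complex.ofRealCLM.contDiff.comp hu)
    have hφ : ∀ x, φ x = (u x : ℂ) := fun x => rfl
    have e : ∀ x, u x • (g₁ x - g₂ x) = g₁ x * φ x - g₂ x * φ x := fun x => by
      rw [hφ, Complex.real_smul]; ring
    simp_rw [e]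
    rw [integral_sub (h₁.integrable_right φ) (h₂.integrable_right φ), h₁.integral_eq,
      h₂.integral_eq, sub_self]

end Uniqueness

/-- The Fourier transform commutes with linear isometries, so it keeps the invariance and the
evenness of `h`. -/
theorem testFourier_comp_isometry {E : Type*} [NormedAddCommGroup E] [InnerProductSpace ℝ E]
    [FiniteDimensional ℝ E] [MeasurableSpace E] [BorelSpace E] (A : E ≃ₗᵢ[ℝ] E) {h : 𝓢(E, ℂ)}
    (hA : ∀ x, h (A x) = h x) (x : E) : testFourier h (A x) = testFourier h x := by
  rw [testFourier_eq_fourier, testFourier_eq_fourier, ← map_smul, SchwartzMap.fourier_coe,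
    ← Real.fourier_comp_linearIsometry]
  rw [show (h : E → ℂ) ∘ A = h from funext hA]

/-! ### Block rotations and orthogonal sequences -/

section Rotation

variable {κ n : ℕ}

/-- A `κ × κ` matrix acting on each of the `n` blocks of a vector. -/
def blockMul (M : Matrix (Fin κ) (Fin κ) ℝ) : Space κ n →ₗ[ℝ] Space κ n where
  toFun x := WithLp.toLp 2 fun p => (M.mulVec fun i => x (p.1, i)) p.2
  map_add' x y := by
    ext p
    exact congrFun (M.mulVec_add (fun i => x (p.1, i)) (fun i => y (p.1, i))) p.2
  map_smul' r x := by
    ext p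
    exact congrFun (M.mulVec_smul r (fun i => x (p.1, i))) p.2

theorem blockMul_apply (M : Matrix (Fin κ) (Fin κ) ℝ) (x : Space κ n) (p : Fin n × Fin κ) :
    blockMul M x p = (M.mulVec fun i => x (p.1, i)) p.2 := rfl

theorem R_eq_blockMul (σ : Matrix.specialOrthogonalGroup (Fin κ) ℝ) (x : Space κ n) :
    R σ x = blockMul (σ : Matrix (Fin κ) (Fin κ) ℝ) x := rfl

theorem sum_smul_blockMul {ι : Type*} (s : Finset ι) (c : ι → ℝ)
    (M : ι → Matrix (Fin κ) (Fin κ) ℝ) (x : Space κ n) :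
    ∑ j ∈ s, c j • blockMul (M j) x = blockMul (∑ j ∈ s, c j • M j) x := by
  ext p
  simp [blockMul_apply, Matrix.sum_mulVec, Matrix.smul_mulVec]

theorem inner_blockMul (M N : Matrix (Fin κ) (Fin κ) ℝ) (x y : Space κ n) :
    ⟪blockMul M x, blockMul N y⟫ =
      ∑ b, (M.mulVec fun i => x (b, i)) ⬝ᵥ (N.mulVec fun i => y (b, i)) := by
  rw [PiLp.inner_apply, Fintype.sum_prod_type]
  refine Finset.sum_congr rfl fun b _ => ?_
  simp [dotProduct, blockMul_apply, mul_comm]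

theorem mulVec_dotProduct_mulVec_of_transpose_mul_self {M : Matrix (Fin κ) (Fin κ) ℝ}
    (hM : M.transpose * M = 1) (v w : Fin κ → ℝ) : M.mulVec v ⬝ᵥ M.mulVec w = v ⬝ᵥ w := by
  rw [Matrix.dotProduct_mulVec, Matrix.vecMul_mulVec, hM, Matrix.vecMul_one]

theorem transpose_mul_self_specialOrthogonalGroup
    (σ : Matrix.specialOrthogonalGroup (Fin κ) ℝ) :
    (σ : Matrix (Fin κ) (Fin κ) ℝ).transpose * (σ : Matrix (Fin κ) (Fin κ) ℝ) = 1 :=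
  (Matrix.mem_orthogonalGroup_iff' (Fin κ) ℝ).1 (Matrix.mem_specialOrthogonalGroup_iff.1 σ.2).1

theorem inner_R_self (σ : Matrix.specialOrthogonalGroup (Fin κ) ℝ) (x y : Space κ n) :
    ⟪R σ x, R σ y⟫ = ⟪x, y⟫ := by
  rw [R_eq_blockMul, R_eq_blockMul, inner_blockMul, PiLp.inner_apply, Fintype.sum_prod_type]
  refine Finset.sum_congr rfl fun b _ => ?_
  rw [mulVec_dotProduct_mulVec_of_transpose_mul_self (transpose_mul_self_specialOrthogonalGroup σ)]
  simp [dotProduct, mul_comm]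

/-- `R σ` as a linear isometry. -/
noncomputable def RIsometry (σ : Matrix.specialOrthogonalGroup (Fin κ) ℝ) :
    Space κ n ≃ₗᵢ[ℝ] Space κ n :=
  ((blockMul (σ : Matrix (Fin κ) (Fin κ) ℝ)).isometryOfInner
    fun x y => inner_R_self σ x y).toLinearIsometryEquiv rfl

theorem RIsometry_apply (σ : Matrix.specialOrthogonalGroup (Fin κ) ℝ) (x : Space κ n) :
    RIsometry σ x = R σ x := rfl

theorem transpose_mul_self_of_forall_dotProduct {M : Matrix (Fin κ) (Fin κ) ℝ}
    (hM : ∀ v, M.mulVec v ⬝ᵥ M.mulVec v = v ⬝ᵥ v) : M.transpose * M = 1 := by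
  have hpol : ∀ v w, M.mulVec v ⬝ᵥ M.mulVec w = v ⬝ᵥ w := fun v w => by
    have h := hM (v + w)
    simp only [Matrix.mulVec_add, dotProduct_add, add_dotProduct, hM] at h
    rw [dotProduct_comm w v, dotProduct_comm (M.mulVec w)] at h
    linarith
  ext i j
  have := hpol (Pi.single i 1) (Pi.single j 1)
  rw [Matrix.mulVec_single_one, Matrix.mulVec_single_one] at this
  simpa [Matrix.mul_apply, dotProduct, Matrix.one_apply, Pi.single_apply, eq_comm] using this

variable [NeZero κ] {σ : Fin κ → Matrix.specialOrthogonalGroup (Fin κ) ℝ}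

theorem IsOrthogonalSequence.orthonormal_R (hσ : IsOrthogonalSequence σ) {ξ : Space κ n}
    (hξ : ‖ξ‖ = 1) : Orthonormal ℝ (fun j => R (σ j) ξ) := by
  refine ⟨fun j => ?_, fun i j hij => ?_⟩
  · change ‖R (σ j) ξ‖ = 1
    rw [← RIsometry_apply, LinearIsometryEquiv.norm_map, hξ]
  · change ⟪R (σ i) ξ, R (σ j) ξ⟫ = 0
    rw [R_eq_blockMul, R_eq_blockMul, inner_blockMul]
    exact Finset.sum_eq_zero fun b _ => hσ.orthogonal i j hij _

/-- The linear combination `∑ c_j σ_j` of the rotations of a sequence. -/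
def combination (σ : Fin κ → Matrix.specialOrthogonalGroup (Fin κ) ℝ)
    (c : EuclideanSpace ℝ (Fin κ)) : Matrix (Fin κ) (Fin κ) ℝ :=
  ∑ j, c j • (σ j : Matrix (Fin κ) (Fin κ) ℝ)

/-- In the expanded square the cross terms vanish by orthogonality, and the diagonal terms sum to `∑
c_j² = 1` times `v ⬝ᵥ v`. -/
theorem IsOrthogonalSequence.dotProduct_combination (hσ : IsOrthogonalSequence σ)
    {c : EuclideanSpace ℝ (Fin κ)} (hc : ‖c‖ = 1) (v : Fin κ → ℝ) :
    (combination σ c).mulVec v ⬝ᵥ (combination σ c).mulVec v = v ⬝ᵥ v := by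
  have h1 : ∑ j, c j * c j = 1 := by
    have := EuclideanSpace.real_norm_sq_eq c
    rw [hc] at this
    simpa [sq] using this.symm
  simp only [combination, Matrix.sum_mulVec, Matrix.smul_mulVec, sum_dotProduct, dotProduct_sum,
    smul_dotProduct, dotProduct_smul, smul_eq_mul]
  rw [← one_mul (v ⬝ᵥ v), ← h1, Finset.sum_mul]
  refine Finset.sum_congr rfl fun i _ => ?_
  rw [Finset.sum_eq_single i]
  · rw [mulVec_dotProduct_mulVec_of_transpose_mul_self
      (transpose_mul_self_specialOrthogonalGroup _), mul_assoc]
  · intro j _ hj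
    simp [hσ.orthogonal j i hj v]
  · simp

theorem IsOrthogonalSequence.transpose_combination_mul_self (hσ : IsOrthogonalSequence σ)
    {c : EuclideanSpace ℝ (Fin κ)} (hc : ‖c‖ = 1) :
    (combination σ c).transpose * combination σ c = 1 :=
  transpose_mul_self_of_forall_dotProduct (hσ.dotProduct_combination hc)

/-- The determinant is continuous with values `±1` on the unit sphere of coefficients, which is
connected for `κ ≥ 2`, and it is 1 at the coefficient vector of `σ₀ = Id`. -/
theorem IsOrthogonalSequence.det_combination (hσ : IsOrthogonalSequence σ) (hκ : 2 ≤ κ)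
    {c : EuclideanSpace ℝ (Fin κ)} (hc : ‖c‖ = 1) : (combination σ c).det = 1 := by
  have hsq : ∀ u : EuclideanSpace ℝ (Fin κ), ‖u‖ = 1 → (combination σ u).det ^ 2 = 1 :=
    fun u hu => by
      have := congrArg Matrix.det (hσ.transpose_combination_mul_self hu)
      rwa [Matrix.det_mul, Matrix.det_transpose, Matrix.det_one, ← sq] at this
  have hcont : Continuous fun u : EuclideanSpace ℝ (Fin κ) => (combination σ u).det := by
    unfold combination
    fun_prop
  have hpre : IsPreconnected (Metric.sphere (0 : EuclideanSpace ℝ (Fin κ)) 1) :=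
    isPreconnected_sphere (by
      rw [← Module.finrank_eq_rank, finrank_euclideanSpace_fin]; exact_mod_cast hκ) 0 1
  have hdet : (combination σ c).det = 1 ∨ (combination σ c).det = -1 := by simpa using hsq c hc
  rcases hdet with h | h
  · exact h
  · exfalso
    set e : EuclideanSpace ℝ (Fin κ) := EuclideanSpace.single 0 1
    have he : ‖e‖ = 1 := by simp [e]
    have hde : (combination σ e).det = 1 := by
      have : combination σ e = 1 := by
        simp [combination, e, hσ.zero_eq_one]
      rw [this, Matrix.det_one]
    obtain ⟨u, hu, hu0⟩ := hpre.intermediate_value (a := c) (b := e) (by simpa using hc)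
      (by simpa using he) hcont.continuousOn
      (show (0 : ℝ) ∈ Icc _ _ by simp only [h, hde]; norm_num)
    have := hsq u (by simpa using hu)
    simp only at hu0
    rw [hu0] at this
    norm_num at this

/-- A function invariant under the rotations `R_τ` and even is radial on the span of
`ξ, R_{σ₁} ξ, …, R_{σ_{κ-1}} ξ`. -/
theorem IsOrthogonalSequence.apply_sum_smul_R {X : Type*} (hσ : IsOrthogonalSequence σ)
    {ψ : Space κ n → X} (hψ : ∀ τ x, ψ (R τ x) = ψ x) (hneg : ∀ x, ψ (-x) = ψ x)
    (c : EuclideanSpace ℝ (Fin κ)) (ξ : Space κ n) :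
    ψ (∑ j, c j • R (σ j) ξ) = ψ (‖c‖ • ξ) := by
  by_cases hc0 : c = 0
  · simp [hc0]
  have hpos : 0 < ‖c‖ := norm_pos_iff.2 hc0
  set u : EuclideanSpace ℝ (Fin κ) := ‖c‖⁻¹ • c
  have hu : ‖u‖ = 1 := by simp [u, norm_smul, hpos.ne']
  have hcu : c = ‖c‖ • u := by simp [u, smul_smul, hpos.ne']
  have hsum : ∑ j, c j • R (σ j) ξ = blockMul (combination σ u) (‖c‖ • ξ) := by
    simp_rw [R_eq_blockMul]
    rw [sum_smul_blockMul, map_smul, combination, ← sum_smul_blockMul, ← sum_smul_blockMul,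
      Finset.smul_sum]
    refine Finset.sum_congr rfl fun j _ => ?_
    rw [smul_smul]
    congr 1
    exact congrArg (fun v : EuclideanSpace ℝ (Fin κ) => v j) hcu
  rw [hsum]
  -- For `κ = 1` the sphere `{±1}` is disconnected and `-1` is not in `SO(1)`; evenness of `ψ`
  -- replaces rotation invariance.
  rcases (show κ = 1 ∨ 2 ≤ κ by have := NeZero.ne κ; omega) with hκ | hκ
  · subst hκ
    have hu0 : u 0 ^ 2 = 1 := by
      have := EuclideanSpace.real_norm_sq_eq u
      rw [hu] at this
      simpa using this.symm
    have hM : combination σ u = u 0 • 1 := by simp [combination, hσ.zero_eq_one]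
    have h1 : ∀ x : Space 1 n, blockMul (1 : Matrix (Fin 1) (Fin 1) ℝ) x = x := fun x => by
      ext p; simp [blockMul_apply]
    have h2 : ∀ (r : ℝ) (x : Space 1 n),
        blockMul (r • (1 : Matrix (Fin 1) (Fin 1) ℝ)) x = r • x := fun r x => by
      have := sum_smul_blockMul {()} (fun _ => r) (fun _ => (1 : Matrix (Fin 1) (Fin 1) ℝ)) x
      simpa [h1] using this.symm
    rw [hM, h2]
    rcases (show u 0 = 1 ∨ u 0 = -1 by simpa using hu0) with h | h
    · rw [h, one_smul]
    · rw [h, neg_one_smul, hneg]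
  · exact hψ ⟨combination σ u, Matrix.mem_specialOrthogonalGroup_iff.2
      ⟨(Matrix.mem_orthogonalGroup_iff' (Fin κ) ℝ).2 (hσ.transpose_combination_mul_self hu),
        hσ.det_combination hκ hu⟩⟩ _

/-- The isometric embedding `c ↦ ∑ c_j R_{σ_j} ξ`. -/
noncomputable def spanIsometry (hσ : IsOrthogonalSequence σ) {ξ : Space κ n} (hξ : ‖ξ‖ = 1) :
    EuclideanSpace ℝ (Fin κ) →ₗᵢ[ℝ] Space κ n :=
  ((EuclideanSpace.basisFun (Fin κ) ℝ).toBasis.constr ℝ fun j => R (σ j) ξ).isometryOfOrthonormal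
    (v := (EuclideanSpace.basisFun (Fin κ) ℝ).toBasis)
    (by simp)
    (by
      convert hσ.orthonormal_R hξ using 1
      ext1 j
      simp only [Function.comp_apply, Module.Basis.constr_basis])

theorem spanIsometry_apply (hσ : IsOrthogonalSequence σ) {ξ : Space κ n} (hξ : ‖ξ‖ = 1)
    (c : EuclideanSpace ℝ (Fin κ)) : spanIsometry hσ hξ c = ∑ j, c j • R (σ j) ξ := by
  change (EuclideanSpace.basisFun (Fin κ) ℝ).toBasis.constr ℝ (fun j => R (σ j) ξ) c = _
  rw [Module.Basis.constr_apply_fintype]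
  simp

theorem inner_spanIsometry_H (hσ : IsOrthogonalSequence σ) {ξ : Space κ n} (hξ : ‖ξ‖ = 1)
    (c : EuclideanSpace ℝ (Fin κ)) (w : H σ ξ) :
    ⟪spanIsometry hσ hξ c, (H σ ξ).subtypeₗᵢ w⟫ = 0 := by
  refine Submodule.inner_right_of_mem_orthogonal
    (K := Submodule.span ℝ (Set.range fun j => R (σ j) ξ)) ?_ w.2
  rw [spanIsometry_apply]
  exact Submodule.sum_mem _ fun j _ =>
    Submodule.smul_mem _ _ (Submodule.subset_span (Set.mem_range_self j))

theorem finrank_H (hσ : IsOrthogonalSequence σ) {ξ : Space κ n} (hξ : ‖ξ‖ = 1) :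
    κ + Module.finrank ℝ (H σ ξ) = κ * n := by
  have h1 := Submodule.finrank_add_finrank_orthogonal
    (Submodule.span ℝ (Set.range fun j => R (σ j) ξ))
  rw [finrank_span_eq_card (hσ.orthonormal_R hξ).linearIndependent, Fintype.card_fin,
    finrank_euclideanSpace, Fintype.card_prod, Fintype.card_fin, Fintype.card_fin] at h1
  rw [mul_comm κ n]
  exact h1

end Rotation

/-! ### Section volumes and the radial identity at `ξ` -/

section SectionVolume

variable {E W : Type*} [NormedAddCommGroup E] [NormedSpace ℝ E]
  [NormedAddCommGroup W] [InnerProductSpace ℝ W] [FiniteDimensional ℝ W]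
  [MeasurableSpace W] [BorelSpace W] [Nontrivial W] {K : Set E}

/-- The pulled-back gauge is a norm on `W` whose closed unit ball is the section. -/
theorem integral_comp_gauge_linear (hconv : Convex ℝ K) (hclosed : IsClosed K)
    (hbdd : Bornology.IsBounded K) (hK : K ∈ nhds (0 : E)) (hsymm : ∀ x ∈ K, -x ∈ K)
    (j : W →ₗ[ℝ] E) (hj : Function.Injective j) (η : ℝ → ℝ) :
    ∫ w, η (gauge K (j w)) = Module.finrank ℝ W * (volume (j ⁻¹' K)).toReal *
      ∫ t in Ioi (0 : ℝ), t ^ (Module.finrank ℝ W - 1) * η t := by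
  have h1 : gauge K (j 0) = 0 := by rw [map_zero, gauge_zero]
  have h2 : ∀ w, gauge K (j (-w)) = gauge K (j w) := fun w => by rw [map_neg, gauge_neg hsymm]
  have h3 : ∀ v w, gauge K (j (v + w)) ≤ gauge K (j v) + gauge K (j w) := fun v w => by
    rw [map_add]
    exact gauge_add_le hconv (absorbent_nhds_zero hK) _ _
  have h4 : ∀ {w}, gauge K (j w) = 0 → w = 0 := fun {w} hw => by
    by_contra hne
    exact (gauge_pos_of_ne_zero hK hbdd ((map_ne_zero_iff j hj).2 hne)).ne' hw
  have h5 : ∀ (r : ℝ) (w : W), gauge K (j (r • w)) ≤ |r| * gauge K (j w) := fun r w => by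
    rw [map_smul, gauge_smul_of_symmetric hsymm]
  have hset : j ⁻¹' K = {w | gauge K (j w) ≤ 1} := by
    ext w
    rw [mem_preimage, mem_ofPred_eq, gauge_le_one_iff_mem_closure hconv hK, hclosed.closure_eq]
  have key := integral_comp_norm_like (volume : Measure W) h1 h2 h3 h4 h5 η
  -- The polar formula involves the open unit ball; the unit sphere of a norm is null.
  rw [key, hset, measure_le_eq_lt (volume : Measure W) h1 h2 h3 h4 h5 1]
  simp only [nsmul_eq_mul, smul_eq_mul, Measure.real, mul_assoc]

end SectionVolume

/-- Both sides are the surface area of `S^{κ-1}`. -/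
theorem volume_ball_mul_finrank {κ : ℕ} [NeZero κ] :
    (κ : ℝ) * (volume : Measure (EuclideanSpace ℝ (Fin κ))).real (Metric.ball 0 1) =
      2 * Real.pi ^ ((κ : ℝ) / 2) / Real.Gamma ((κ : ℝ) / 2) := by
  have hκ : (0 : ℝ) < κ := by exact_mod_cast Nat.pos_of_ne_zero (NeZero.ne κ)
  have hΓ : 0 < Real.Gamma ((κ : ℝ) / 2) := Real.Gamma_pos_of_pos (by positivity)
  have hΓ' : 0 < Real.Gamma ((κ : ℝ) / 2 + 1) := Real.Gamma_pos_of_pos (by positivity)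
  rw [Measure.real, EuclideanSpace.volume_ball, Fintype.card_fin, ENNReal.ofReal_one, one_pow,
    one_mul, ENNReal.toReal_ofReal (by positivity), Real.Gamma_add_one (by positivity),
    Real.sqrt_eq_rpow, ← Real.rpow_mul_natCast Real.pi_pos.le, one_div_mul_eq_div]
  field_simp

/-- The integral over `H_ξ` of an even test function invariant under all rotations `R_τ`, in terms
of the radial integral of its Fourier transform at `ξ`. -/
theorem IsOrthogonalSequence.radialFourier_eq {κ n : ℕ} [NeZero κ]
    {σ : Fin κ → Matrix.specialOrthogonalGroup (Fin κ) ℝ} (hσ : IsOrthogonalSequence σ)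
    {h : 𝓢(Space κ n, ℂ)} (hinv : ∀ τ x, h (R τ x) = h x) (hneg : ∀ x, h (-x) = h x)
    {ξ : Space κ n} (hξ : ‖ξ‖ = 1) :
    ((2 * Real.pi ^ ((κ : ℝ) / 2) / Real.Gamma ((κ : ℝ) / 2) : ℝ) : ℂ) * radialFourier κ h ξ =
      (((2 * Real.pi) ^ κ : ℝ) : ℂ) *
        ∫ w : H σ ξ, h w ∂(@volume (H σ ξ) measureSpaceOfInnerProductSpace) := by
  have hd : Module.finrank ℝ (EuclideanSpace ℝ (Fin κ)) + Module.finrank ℝ (H σ ξ) =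
      Module.finrank ℝ (Space κ n) := by
    rw [finrank_euclideanSpace_fin, finrank_H hσ hξ, finrank_euclideanSpace, Fintype.card_prod,
      Fintype.card_fin, Fintype.card_fin, mul_comm]
  have h1 := integral_testFourier_comp_isometry (spanIsometry hσ hξ) (H σ ξ).subtypeₗᵢ
    (inner_spanIsometry_H hσ hξ) hd h
  have hrad : ∀ c, testFourier h (spanIsometry hσ hξ c) = testFourier h (‖c‖ • ξ) := fun c => by
    rw [spanIsometry_apply]
    exact hσ.apply_sum_smul_R (fun τ x => testFourier_comp_isometry (RIsometry τ) (hinv τ) x)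
      (fun x => testFourier_comp_isometry (LinearIsometryEquiv.neg ℝ) hneg x) c ξ
  simp_rw [hrad] at h1
  rw [integral_fun_norm_addHaar volume (fun t => testFourier h (t • ξ)),
    finrank_euclideanSpace_fin, ← smul_assoc, nsmul_eq_mul, volume_ball_mul_finrank,
    Complex.real_smul, Complex.real_smul] at h1
  exact h1

end BlockRotation

/-! ### The volume formula -/

open BlockRotation in
theorem theorem3p2 (κ n : ℕ) [NeZero κ] (hn : 2 ≤ n)
    (σ : Fin κ → Matrix.specialOrthogonalGroup (Fin κ) ℝ) (hσ : IsOrthogonalSequence σ)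
    (K : ConvexBody (Space κ n)) (hK_int : (interior (K : Set (Space κ n))).Nonempty)
    (hK_symm : ∀ x ∈ K, -x ∈ K)
    (hK_smooth : IsInfinitelySmooth (K : Set (Space κ n)))
    (hK_inv : IsRInvariant (K : Set (Space κ n))) :
    (∃ g : Space κ n → ℂ,
      IsFourierTransform (fun x => gauge (K : Set (Space κ n)) x ^ (-(κ * n : ℝ) + κ)) g) ∧
    ∀ g : Space κ n → ℂ,
      IsFourierTransform (fun x => gauge (K : Set (Space κ n)) x ^ (-(κ * n : ℝ) + κ)) g →
      ∀ ξ : Space κ n, ‖ξ‖ = 1 →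
        (sectionVolume (K : Set (Space κ n)) (H σ ξ) : ℂ) =
          (((2 : ℝ) ^ (-(κ : ℝ) + 1) * Real.pi ^ (-(κ : ℝ) / 2) /
            (((κ : ℝ) * n - κ) * Real.Gamma ((κ : ℝ) / 2)) : ℝ) : ℂ) * g ξ := by
  have hκ : 1 ≤ κ := Nat.one_le_iff_ne_zero.2 (NeZero.ne κ)
  have hconv := K.convex
  have hbdd := K.isCompact.isBounded
  have hK := mem_nhds_zero_of_symmetric hconv hK_int hK_symm
  obtain ⟨p, hp⟩ : ∃ p, κ * n = p + κ :=
    ⟨κ * n - κ, (Nat.sub_add_cancel (Nat.le_mul_of_pos_right κ (by omega))).symm⟩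
  have hp1 : 1 ≤ p := by nlinarith
  have hpR : (κ : ℝ) * n = p + κ := by exact_mod_cast hp
  have hfin : p + κ = Module.finrank ℝ (Space κ n) := by
    rw [finrank_euclideanSpace, Fintype.card_prod, Fintype.card_fin, Fintype.card_fin, mul_comm n,
      hp]
  have : Nontrivial (Space κ n) := Module.nontrivial_of_finrank_pos (R := ℝ) (by omega)
  have hexp : -(κ * n : ℝ) + κ = -(p : ℝ) := by rw [hpR]; ring
  rw [hexp]
  obtain ⟨η, hηs, hη0, hη1, hη3, hη2⟩ := exists_bump
  have hI := integral_pow_mul_bump_pos hηs.continuous hη0 hη1 hη3 hη2 (p - 1)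
  set I : ℝ := ∫ t in Set.Ioi (0 : ℝ), t ^ (p - 1) * η t with hIdef
  have hcs : HasCompactSupport fun x => (η (gauge (K : Set (Space κ n)) x) : ℂ) :=
    (hasCompactSupport_comp_gauge hK hbdd hη3).comp_left (g := fun t : ℝ => (t : ℂ))
      Complex.ofReal_zero
  let h : 𝓢(Space κ n, ℂ) :=
    hcs.toSchwartzMap (Complex.ofRealCLM.contDiff.comp (contDiff_comp_gauge hK_smooth hK hηs hη1))
  have hh : ∀ x, h x = (η (gauge (K : Set (Space κ n)) x) : ℂ) := fun x => rfl
  have hpos : ∀ x : Space κ n, x ≠ 0 → 0 < gauge (K : Set (Space κ n)) x := fun x hx =>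
    gauge_pos_of_ne_zero hK hbdd hx
  have hFT : IsFourierTransform (fun x => gauge (K : Set (Space κ n)) x ^ (-(p : ℝ)))
      (fun ξ => ((I⁻¹ : ℝ) : ℂ) * radialFourier κ h ξ) := by
    obtain ⟨a, ha, hle⟩ := exists_mul_norm_le_gauge hK hbdd
    refine isFourierTransform_radialFourier (C := a ^ (-(p : ℝ))) hp1 hκ hfin h hh
      (fun x => hη0 _) (inv_pos.2 hI) ?_ (fun x hx => ?_)
      (fun x hx => Real.rpow_pos_of_pos (hpos x hx) _) (fun x hx => ?_)
    · exact (continuous_gauge hconv hK).continuousOn.rpow_const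
        fun x hx => Or.inl (hpos x hx).ne'
    · rw [← Real.mul_rpow ha.le (norm_nonneg x)]
      exact Real.rpow_le_rpow_of_nonpos (mul_pos ha (norm_pos_iff.2 hx)) (hle x) (by simp)
    · have hcongr : ∫ s in Set.Ioi (0 : ℝ),
            (s ^ (p + 1))⁻¹ * η (gauge (K : Set (Space κ n)) (s⁻¹ • x)) =
          ∫ s in Set.Ioi (0 : ℝ), (s ^ (p + 1))⁻¹ * η (s⁻¹ * gauge (K : Set (Space κ n)) x) := by
        refine setIntegral_congr_fun measurableSet_Ioi fun s (hs : 0 < s) => ?_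
        simp only [gauge_smul_of_nonneg (inv_nonneg.2 hs.le), smul_eq_mul]
      rw [hcongr, integral_inv_pow_mul_comp_inv_mul hp1 η (hpos x hx), ← hIdef,
        Real.rpow_neg (hpos x hx).le, Real.rpow_natCast]
      field_simp
  refine ⟨⟨_, hFT⟩, fun g hg ξ hξ => ?_⟩
  have hξ0 : ξ ≠ 0 := by rintro rfl; simp at hξ
  rw [hg.eqOn_compl_zero hFT hξ0]
  have hrank : Module.finrank ℝ (H σ ξ) = p := by have := finrank_H hσ hξ; omega
  have : Nontrivial (H σ ξ) := Module.nontrivial_of_finrank_pos (R := ℝ) (by omega)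
  have h1 := hσ.radialFourier_eq (h := h) (fun τ x => by rw [hh, hh, hK_inv τ x])
    (fun x => by rw [hh, hh, gauge_neg hK_symm]) hξ
  have h2 := integral_comp_gauge_linear hconv K.isClosed hbdd hK hK_symm (H σ ξ).subtype
    Subtype.val_injective η
  rw [hrank, ← hIdef] at h2
  have h3 : ∫ w : H σ ξ, h w ∂(@volume (H σ ξ) measureSpaceOfInnerProductSpace) =
      ((p * sectionVolume (K : Set (Space κ n)) (H σ ξ) * I : ℝ) : ℂ) := by
    rw [sectionVolume]
    exact (integral_complex_ofReal).trans (congrArg _ h2)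
  rw [h3] at h1
  have hΓ : 0 < Real.Gamma ((κ : ℝ) / 2) := Real.Gamma_pos_of_pos (by positivity)
  have hpp : (0 : ℝ) < p := by exact_mod_cast hp1
  set S := sectionVolume (K : Set (Space κ n)) (H σ ξ)
  have hpi := Real.pi_pos
  -- The stated constant is the area of `S^{κ-1}` divided by `(2π)^κ p`.
  have hcoef : (2 : ℝ) ^ (-(κ : ℝ) + 1) * Real.pi ^ (-(κ : ℝ) / 2) /
      (((κ : ℝ) * n - κ) * Real.Gamma ((κ : ℝ) / 2)) =
      (2 * Real.pi ^ ((κ : ℝ) / 2) / Real.Gamma ((κ : ℝ) / 2)) / ((2 * Real.pi) ^ κ * p) := by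
    have e1 : (2 : ℝ) ^ (-(κ : ℝ) + 1) = 2 / 2 ^ κ := by
      rw [Real.rpow_add two_pos, Real.rpow_neg two_pos.le, Real.rpow_natCast, Real.rpow_one]
      ring
    have e2 : Real.pi ^ (-(κ : ℝ) / 2) = Real.pi ^ ((κ : ℝ) / 2) / Real.pi ^ κ := by
      rw [← Real.rpow_natCast Real.pi κ, ← Real.rpow_sub hpi]
      congr 1
      ring
    rw [e1, e2, hpR, mul_pow, add_sub_cancel_right]
    field_simp
  rw [hcoef]
  have hA : (((2 * Real.pi) ^ κ * p : ℝ) : ℂ) ≠ 0 := by exact_mod_cast (by positivity)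
  have hIc : (I : ℂ) ≠ 0 := by exact_mod_cast hI.ne'
  rw [Complex.ofReal_div (2 * Real.pi ^ ((κ : ℝ) / 2) / Real.Gamma ((κ : ℝ) / 2)),
    Complex.ofReal_inv, div_mul_eq_mul_div, eq_div_iff hA, mul_left_comm, h1]
  push_cast
  field_simp
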